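/- Let $G=(V,E)$ be a connected undirected simple graph with $n$ nodes and maximum degree $\Delta_{\max}$, and let $$\phi_G=\min_{S\subseteq V,\ 1\le |S|\le\lfloor n/2\rfloor}\frac{|E(S,S^c)|}{|S|}$$ be its Cheeger constant (for $n=1$ no such $S$ exists, and $\phi_G$ does not enter below), where $E(S,S^c)$ is the set of edges with one end in $S$ and the other outside $S$. Let $p\in[0,\tfrac12]$, $\mathcal Y=\{-1,1\}^V$ and $\mathcal X=\{-1,1\}^E$. A label vector $y^*$ is drawn uniformly from $\mathcal Y$; given $y^*$, the observations $X=(X_{ij})_{\{i,j\}\in E}\in\mathcal X$ are independent, with $X_{ij}=y_i^*y_j^*$ with probability $1-p$ and $X_{ij}=-y_i^*y_j^*$ with probability $p$. Let $\mathcal P$ be any family of probability distributions on $\mathcal Y\times\mathcal X$ that contains this law of $(y^*,X)$ (for instance, all joint laws with the given conditional law of $X$ given $y^*$ and an arbitrary law of $y^*$). Then $$\inf_{\hat y:\mathcal X\to\mathcal Y}\ \sup_{P\in\mathcal P}\ \mathbb P_{(y^*,X)\sim P}\big[\hat y(X)\ne y^*\big]\ \ge\ \max\{f_1,g_1,g_1^*\},$$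 where, with $H^*(p)=-p\log p-(1-p)\log(1-p)$ (natural logarithm, $0\log 0=0$), $0^0=1$, $a\wedge b=\min\{a,b\}$ and $a\vee b=\max\{a,b\}$, $$f_1=\frac12\sum_{m=0}^{\Delta_{\max}}\binom{\Delta_{\max}}{m}\Big[\big\{(1-p)^m p^{\Delta_{\max}-m}\big\}\wedge\big\{p^m(1-p)^{\Delta_{\max}-m}\big\}\Big],$$ $$g_1=\frac{n-1}{n}-\frac{|E|}{n}\Big(1-\frac{H^*(p)}{\log 2}\Big),$$ $$g_1^*=g_1+\frac{(|E|\log 2-\kappa_1)\vee 0}{n\log 2}\cdot\mathbb I\big[(1-p)^{|E|}\le e^{-1}\big],$$ $$\kappa_1=-|E|\log(1-p)\,\{2(1-p)\}^{|E|}\,\mathbb E_B\Big[\frac{\tau(B)}{2^n}\Big]+\{2(1-p)\}^{|E|}\,\mathbb E_B\Big[-\frac{\tau(B)}{2^n}\log\Big(\frac{\tau(B)}{2^n}\Big)\Big],$$ $$\tau(b)=2\Big(\frac{p}{1-p}\Big)^{b}+\sum_{k=1}^{n-1}\binom nk\Big(\frac{p}{1-p}\Big)^{(\phi_G\cdot\{k\wedge(n-k)\}-b)\vee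 0},\qquad B\sim\mathrm{Bin}\big(|E|-n+1,\tfrac12\big).$$ -/

import Mathlib

namespace EdgeRecovery

noncomputable section

variable {V : Type*} [Fintype V]

/-- Label vectors `y ∈ {-1, 1}^V`; the group `ℤˣ` of units of `ℤ` is exactly `{-1, 1}`. -/
abbrev Labels (V : Type*) : Type _ := V → ℤˣ

/-- Edge observations: a sign in `{-1, 1}` for every edge of `G`. -/
abbrev Observations (G : SimpleGraph V) : Type _ := G.edgeSet → ℤˣ

/-- The product `y i * y j` of the labels at the two ends of an edge `e = {i, j}`. -/
def edgeProduct (G : SimpleGraph V) (y : Labels V) (e : G.edgeSet) : ℤˣ :=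
  (Sym2.map y e.1).mul

/-- The conditional probability of one edge sign `x` given the true product `s` of the labels at
its ends: `1 - p` if `x = s`, and `p` if `x = -s`. -/
def edgeProb (p : ℝ) (x s : ℤˣ) : ℝ := if x = s then 1 - p else p

/-- The conditional probability mass function `p(X | y)`: given `y`, the edge signs are
independent, and each one is wrong with probability `p`. -/
def obsProb (G : SimpleGraph V) [DecidableRel G.Adj] (p : ℝ) (y : Labels V)
    (X : Observations G) : ℝ :=
  ∏ e : G.edgeSet, edgeProb p (X e) (edgeProduct G y e)

lemma sum_edgeProb (p : ℝ) (s : ℤˣ) : ∑ x : ℤˣ, edgeProb p x s = 1 := by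
  rcases Int.units_eq_one_or s with rfl | rfl <;> simp [edgeProb]

lemma edgeProb_nonneg {p : ℝ} (hp : p ∈ Set.Icc (0 : ℝ) (1 / 2)) (x s : ℤˣ) :
    0 ≤ edgeProb p x s := by
  obtain ⟨h0, h1⟩ := hp
  unfold edgeProb
  split_ifs <;> linarith

lemma obsProb_nonneg (G : SimpleGraph V) [DecidableRel G.Adj] {p : ℝ}
    (hp : p ∈ Set.Icc (0 : ℝ) (1 / 2)) (y : Labels V) (X : Observations G) :
    0 ≤ obsProb G p y X :=
  Finset.prod_nonneg fun _ _ => edgeProb_nonneg hp _ _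

lemma sum_obsProb [DecidableEq V] (G : SimpleGraph V) [DecidableRel G.Adj] (p : ℝ) (y : Labels V) :
    ∑ X : Observations G, obsProb G p y X = 1 := by
  unfold obsProb
  rw [← Fintype.prod_sum (fun e x => edgeProb p x (edgeProduct G y e))]
  exact Finset.prod_eq_one fun e _ => sum_edgeProb p _

/-- The conditional law of the observation `X` given the label vector `y`. -/
def channel [DecidableEq V] (G : SimpleGraph V) [DecidableRel G.Adj] (p : ℝ)
    (hp : p ∈ Set.Icc (0 : ℝ) (1 / 2)) (y : Labels V) : PMF (Observations G) :=
  PMF.ofFintype (fun X => ENNReal.ofReal (obsProb G p y X)) (by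
    rw [← ENNReal.ofReal_sum_of_nonneg fun X _ => obsProb_nonneg G hp y X, sum_obsProb,
      ENNReal.ofReal_one])

/-- The joint law of `(y*, X)` in the inference problem: `y*` is uniform on `{-1, 1}^V`, and `X`
is then drawn from the conditional law given `y*`. -/
def jointLaw [DecidableEq V] (G : SimpleGraph V) [DecidableRel G.Adj] (p : ℝ)
    (hp : p ∈ Set.Icc (0 : ℝ) (1 / 2)) : PMF (Labels V × Observations G) :=
  (PMF.uniformOfFintype (Labels V)).bind fun y => (channel G p hp y).map fun X => (y, X)

/-- The probability, under `(y*, X) ∼ P`, that the estimator `yhat` fails to recover `y*`. -/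
def errorProb (G : SimpleGraph V) (yhat : Observations G → Labels V)
    (P : PMF (Labels V × Observations G)) : ENNReal :=
  P.toOuterMeasure {w | yhat w.2 ≠ w.1}

/-- The minimax probability of error over a family `Q` of joint laws: the infimum over all
estimators of the supremum over `Q` of the probability of failure. -/
def minimaxError (G : SimpleGraph V) (Q : Set (PMF (Labels V × Observations G))) : ENNReal :=
  ⨅ yhat : Observations G → Labels V, ⨆ P ∈ Q, errorProb G yhat P

/-- The Cheeger constant (edge expansion): the minimum of `|E(S, Sᶜ)| / |S|` over the vertex sets
`S` with `1 ≤ |S| ≤ ⌊n / 2⌋`. (`G.interedges S Sᶜ` lists every edge between `S` and `Sᶜ` once,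
with its end in `S` first.) -/
def cheeger [DecidableEq V] (G : SimpleGraph V) [DecidableRel G.Adj] : ℝ :=
  ⨅ S : {S : Finset V // 1 ≤ S.card ∧ S.card ≤ Fintype.card V / 2},
    ((G.interedges S.1 S.1ᶜ).card : ℝ) / (S.1.card : ℝ)

/-- The lower bound `f₁`, with `d` the maximum degree. -/
def f1 (d : ℕ) (p : ℝ) : ℝ :=
  1 / 2 * ∑ m ∈ Finset.range (d + 1),
    (d.choose m : ℝ) * min ((1 - p) ^ m * p ^ (d - m)) (p ^ m * (1 - p) ^ (d - m))

/-- The lower bound `g₁`, for `n` vertices and `E` edges. `Real.binEntropy` is the binary entropy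
function in natural units. -/
def g1 (n E : ℕ) (p : ℝ) : ℝ :=
  ((n : ℝ) - 1) / n - (E : ℝ) / n * (1 - Real.binEntropy p / Real.log 2)

/-- `τ(b)`, for `n` vertices and Cheeger constant `φ`. -/
def tau (n : ℕ) (φ p : ℝ) (b : ℕ) : ℝ :=
  2 * (p / (1 - p)) ^ b +
    ∑ k ∈ Finset.Icc 1 (n - 1),
      (n.choose k : ℝ) * (p / (1 - p)) ^ (max (φ * (min k (n - k) : ℕ) - (b : ℝ)) 0 : ℝ)

/-- The expectation of `h(B)` for `B ∼ Bin(N, 1/2)`. -/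
def binomialHalfExp (N : ℕ) (h : ℕ → ℝ) : ℝ :=
  ∫ b, h b ∂(ProbabilityTheory.binomial N ⟨1 / 2, by norm_num, by norm_num⟩)

/-- `κ₁`, for `n` vertices, `E` edges and Cheeger constant `φ`. In a connected graph
`E + 1 ≥ n`, so the number of trials `E + 1 - n` is not truncated. -/
def kappa1 (n E : ℕ) (φ p : ℝ) : ℝ :=
  -(E : ℝ) * Real.log (1 - p) * (2 * (1 - p)) ^ E *
      binomialHalfExp (E + 1 - n) (fun b => tau n φ p b / 2 ^ n) +
    (2 * (1 - p)) ^ E *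
      binomialHalfExp (E + 1 - n)
        (fun b => -(tau n φ p b / 2 ^ n) * Real.log (tau n φ p b / 2 ^ n))

/-- The lower bound `g₁*`. -/
def g1star (n E : ℕ) (φ p : ℝ) : ℝ :=
  g1 n E p + max ((E : ℝ) * Real.log 2 - kappa1 n E φ p) 0 / (n * Real.log 2) *
    (if (1 - p) ^ E ≤ Real.exp (-1) then 1 else 0)

end

end EdgeRecovery

/-!
The minimax error is at least the error of the best estimator under the single law `jointLaw`, so
every bound below is on that Bayes risk (`le_toReal_minimaxError`).

* `f1`: label vectors that differ only at a vertex `v` induce the same law on the edges away from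
  `v`. Whatever the estimator, its error on such a pair is at least the overlap of the two laws,
  and the overlap is a binomial sum over the `deg v` edges at `v` (`f1_degree_le_errorProb`).

* `g1`: Fano's inequality (`fano`) bounds the risk by means of the entropy `H(X)` of the
  observations, the conditional entropy `H(X | y)` being `|E|` times the binary entropy of `p`.
  The trivial bound on `H(X)` is `|E| log 2`.

* `g1star`: a better bound on `H(X)`. If `X` disagrees with some labels `y` on `b` edges, then for
  labels `y * u` it disagrees on at least `|cut u| - b` edges, and the expansion of the graph makes
  the cut large; hence `P(X) ≤ (1 - p) ^ |E| * τ(b) / 2 ^ n` (`marginal_le`). The right-hand side is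
  at most `(1 - p) ^ |E| ≤ exp (-1)`, and `t ↦ -t log t` is increasing up to `exp (-1)`, so this
  passes to the entropy. The labels may be chosen to match `X` on a spanning tree
  (`exists_edges_forall_exists_labels`); `b` then counts signs on the `|E| - n + 1` edges off the
  tree, and summing over `X` turns it into a binomial variable (`sum_observations_le`). The
  resulting sum is `κ₁` (`kappa1_eq_sum`).
-/

namespace EdgeRecovery

open Finset

/-! ### Counting sign vectors -/

section Signs

variable {ι : Type*} [Fintype ι]

lemma sum_signs_card [DecidableEq ι] {M : Type*} [AddCommMonoid M] (s : ι → ℤˣ) (F : ℕ → M) :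
    ∑ z : ι → ℤˣ, F #{i | z i ≠ s i} =
      ∑ k ∈ range (Fintype.card ι + 1), (Fintype.card ι).choose k • F k := by
  rw [← card_univ, ← sum_powerset_apply_card, powerset_univ]
  refine Fintype.sum_bijective (fun z : ι → ℤˣ => ({i | z i ≠ s i} : Finset ι)) ?_ _ _
    fun _ => rfl
  refine Function.bijective_iff_has_inverse.2
    ⟨fun S i => if i ∈ S then -s i else s i, fun z => ?_, fun S => ?_⟩
  · funext i
    by_cases h : z i = s i
    · simp [h]
    · simp only [ne_eq, mem_filter, mem_univ, true_and, h, not_false_eq_true, if_true]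
      exact (Int.units_ne_iff_eq_neg.1 h).symm
  · ext i
    by_cases h : i ∈ S <;> simp [h]

lemma prod_edgeProb (p : ℝ) (x s : ι → ℤˣ) :
    ∏ i, edgeProb p (x i) (s i) =
      p ^ #{i | x i ≠ s i} * (1 - p) ^ (Fintype.card ι - #{i | x i ≠ s i}) := by
  have h : Fintype.card ι - #{i | x i ≠ s i} = #{i | x i = s i} := by
    have := card_filter_add_card_filter_not (s := (univ : Finset ι)) (fun i => x i = s i)
    rw [card_univ] at this
    simp only [ne_eq]
    omega
  rw [h]
  simp only [edgeProb, prod_ite, prod_const]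
  rw [mul_comm]

/-- If two sign vectors disagree exactly on the index set `A`, the coordinates outside `A` carry no
information for telling them apart, and the overlap of the two laws is a binomial sum over `A`. -/
lemma sum_min_prod_edgeProb [DecidableEq ι] {p : ℝ} (hp : p ∈ Set.Icc (0 : ℝ) (1 / 2))
    (s s' : ι → ℤˣ) {d : ℕ} (hd : Fintype.card {i // s i ≠ s' i} = d) :
    ∑ x : ι → ℤˣ, min (∏ i, edgeProb p (x i) (s i)) (∏ i, edgeProb p (x i) (s' i)) =
      ∑ m ∈ range (d + 1),
        (d.choose m : ℝ) * min ((1 - p) ^ m * p ^ (d - m)) (p ^ m * (1 - p) ^ (d - m)) := by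
  let e := Equiv.piEquivPiSubtypeProd (fun i => s i ≠ s' i) (fun _ : ι => ℤˣ)
  let F : ℕ → ℝ := fun m => min ((1 - p) ^ m * p ^ (d - m)) (p ^ m * (1 - p) ^ (d - m))
  have key : ∀ x : ι → ℤˣ,
      min (∏ i, edgeProb p (x i) (s i)) (∏ i, edgeProb p (x i) (s' i)) =
        F #{i : {i // s i ≠ s' i} | (e x).1 i ≠ s i} *
          ∏ i : {i // ¬ s i ≠ s' i}, edgeProb p ((e x).2 i) (s i) := by
    intro x
    rw [← Fintype.prod_subtype_mul_prod_subtype (fun i => s i ≠ s' i)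
        (fun i => edgeProb p (x i) (s i)),
      ← Fintype.prod_subtype_mul_prod_subtype (fun i => s i ≠ s' i)
        (fun i => edgeProb p (x i) (s' i))]
    have h2 : ∏ i : {i // ¬ s i ≠ s' i}, edgeProb p (x i) (s' i) =
        ∏ i : {i // ¬ s i ≠ s' i}, edgeProb p (x i) (s i) :=
      Fintype.prod_congr _ _ fun i => by rw [not_not.1 i.2]
    -- the opposite sign amounts to the noise level `1 - p`
    have h1 : ∏ i : {i // s i ≠ s' i}, edgeProb p (x i) (s' i) =
        ∏ i : {i // s i ≠ s' i}, edgeProb (1 - p) (x i) (s i) := by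
      refine Fintype.prod_congr _ _ fun i => ?_
      have h3 := Int.units_ne_iff_eq_neg.1 i.2
      rcases Int.units_eq_one_or (x i) with h | h <;>
      rcases Int.units_eq_one_or (s' i) with h' | h' <;> simp [edgeProb, h, h', h3]
    rw [h2, h1, ← min_mul_of_nonneg _ _ (prod_nonneg fun i _ => edgeProb_nonneg hp _ _),
      prod_edgeProb, prod_edgeProb, hd, min_comm, sub_sub_cancel]
    rfl
  rw [Fintype.sum_congr _ _ key, e.sum_comp
    (fun z => F #{i : {i // s i ≠ s' i} | z.1 i ≠ s i} *
          ∏ i : {i // ¬ s i ≠ s' i}, edgeProb p (z.2 i) (s i)), Fintype.sum_prod_type]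
  simp_rw [← mul_sum]
  have h1 : ∑ z : {i // ¬ s i ≠ s' i} → ℤˣ, ∏ i, edgeProb p (z i) (s i) = 1 := by
    rw [← Fintype.prod_sum (fun (i : {i // ¬ s i ≠ s' i}) x => edgeProb p x (s i.1))]
    exact prod_eq_one fun e _ => sum_edgeProb p _
  rw [h1]
  simp_rw [mul_one]
  rw [sum_signs_card (fun i : {i // s i ≠ s' i} => s i) F, hd]
  simp [F, nsmul_eq_mul]

end Signs

/-! ### Entropy of finite laws -/

section Entropy

lemma negMulLog_prod {ι : Type*} [DecidableEq ι] (A : Finset ι) (a : ι → ℝ) :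
    Real.negMulLog (∏ i ∈ A, a i) =
      ∑ i ∈ A, ∏ j ∈ A, if j = i then Real.negMulLog (a j) else a j := by
  induction A using Finset.induction_on with
  | empty => simp
  | insert i A hi ih =>
    rw [prod_insert hi, Real.negMulLog_mul, ih, sum_insert hi, prod_insert hi, if_pos rfl,
      mul_sum, mul_comm]
    congr 1
    · congr 1
      exact prod_congr rfl fun j hj => by rw [if_neg (by rintro rfl; exact hi hj)]
    · refine sum_congr rfl fun k hk => ?_
      rw [prod_insert hi, if_neg (by rintro rfl; exact hi hk)]

/-- The entropy of a product law is the sum of the entropies of its factors. -/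
lemma sum_negMulLog_prod {ι α : Type*} [Fintype ι] [DecidableEq ι] [Fintype α]
    (f : ι → α → ℝ) (hf : ∀ i, ∑ a, f i a = 1) :
    ∑ x : ι → α, Real.negMulLog (∏ i, f i (x i)) = ∑ i, ∑ a, Real.negMulLog (f i a) := by
  simp_rw [negMulLog_prod]
  rw [sum_comm]
  refine sum_congr rfl fun i _ => ?_
  rw [← Fintype.prod_sum (fun j a => if j = i then Real.negMulLog (f j a) else f j a),
    prod_eq_single i]
  · simp
  · intro j _ hj
    simp [hj, hf]
  · simp

/-- **Gibbs' inequality**: coding a law `f` with a sub-probability `r` costs at least the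
entropy of `f`. -/
lemma sum_negMulLog_le {ι : Type*} [Fintype ι] (f r : ι → ℝ) (hf : ∀ i, 0 ≤ f i)
    (hr : ∀ i, 0 ≤ r i) (hfr : ∀ i, 0 < f i → 0 < r i) (hsum : ∑ i, r i ≤ ∑ i, f i) :
    ∑ i, Real.negMulLog (f i) ≤ -∑ i, f i * Real.log (r i) := by
  have key : ∀ i, Real.negMulLog (f i) + f i * Real.log (r i) ≤ r i - f i := by
    intro i
    rcases (hf i).eq_or_lt with h | h
    · simp [← h, hr i]
    · have hri := hfr i h
      have := Real.log_le_sub_one_of_pos (div_pos hri h)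
      rw [Real.log_div hri.ne' h.ne'] at this
      have h2 := mul_le_mul_of_nonneg_left this h.le
      rw [mul_sub, mul_sub, mul_div_cancel₀ _ h.ne'] at h2
      simp only [Real.negMulLog]
      linarith
  have := sum_le_sum fun i (_ : i ∈ univ) => key i
  rw [sum_add_distrib, sum_sub_distrib] at this
  linarith

lemma sum_negMulLog_le_log_card {ι : Type*} [Fintype ι] [Nonempty ι] (f : ι → ℝ)
    (hf : ∀ i, 0 ≤ f i) (hsum : ∑ i, f i = 1) :
    ∑ i, Real.negMulLog (f i) ≤ Real.log (Fintype.card ι) := by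
  have hc : (0 : ℝ) < Fintype.card ι := by exact_mod_cast Fintype.card_pos
  have := sum_negMulLog_le f (fun _ => (Fintype.card ι : ℝ)⁻¹) hf (fun _ => by positivity)
    (fun _ _ => by positivity) (by simp [hsum, hc.ne'])
  rwa [← sum_mul, hsum, Real.log_inv, one_mul, neg_neg] at this

/-- **Fano's inequality** for a uniform prior: `W y x` is the probability of observing `x` given
`y`, `h` is the entropy of every `W y`, and `g` is any decoder. The left-hand side is the
probability of success times the entropy of the prior.

It is Gibbs' inequality for the joint law against the reference law that has the true marginal in
`x` and, given `x`, puts mass `1 / 2` on the guess `g x` and spreads the rest evenly. -/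
lemma fano {Y X : Type*} [Fintype Y] [Nonempty Y] [DecidableEq Y] [Fintype X]
    (W : Y → X → ℝ) (hW : ∀ y x, 0 ≤ W y x) (hW1 : ∀ y, ∑ x, W y x = 1) {h : ℝ}
    (hh : ∀ y, ∑ x, Real.negMulLog (W y x) = h) (g : X → Y) :
    ((Fintype.card Y : ℝ)⁻¹ * ∑ x, W (g x) x) * Real.log (Fintype.card Y) ≤
      Real.log 2 + ∑ x, Real.negMulLog ((Fintype.card Y : ℝ)⁻¹ * ∑ y, W y x) - h := by
  set N : ℝ := (Fintype.card Y : ℝ) with hN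
  have hN0 : 0 < N := by rw [hN]; exact_mod_cast Fintype.card_pos
  set m : X → ℝ := fun x => N⁻¹ * ∑ y, W y x with hm
  have hm0 : ∀ x, 0 ≤ m x := fun x => mul_nonneg (by positivity) (sum_nonneg fun y _ => hW y x)
  let w : Y → X → ℝ := fun y x => if y = g x then 1 / 2 else 1 / (2 * N)
  have hw0 : ∀ y x, 0 < w y x := fun y x => by simp only [w]; split_ifs <;> positivity
  have hmpos : ∀ y x, 0 < N⁻¹ * W y x → 0 < m x := by
    intro y x hyx
    refine hyx.trans_le (mul_le_mul_of_nonneg_left ?_ (by positivity))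
    exact single_le_sum (f := fun y => W y x) (fun y _ => hW y x) (mem_univ y)
  have hm1 : ∑ x, m x = 1 := by
    simp only [hm]
    rw [← mul_sum, sum_comm]
    simp [hW1, hN0.ne', ← hN]
  have hw1 : ∀ x, ∑ y, w y x ≤ 1 := by
    intro x
    have h1 : ∀ y, w y x ≤ 1 / (2 * N) + if y = g x then 1 / 2 else 0 := by
      intro y
      have : (0 : ℝ) < 1 / (2 * N) := by positivity
      simp only [w]
      split_ifs <;> linarith
    refine (sum_le_sum fun y _ => h1 y).trans ?_
    rw [sum_add_distrib, sum_ite_eq' univ (g x), sum_const, card_univ, nsmul_eq_mul, ← hN,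
      if_pos (mem_univ _)]
    field_simp
    norm_num
  have hj1 : ∑ z : Y × X, N⁻¹ * W z.1 z.2 = 1 := by
    rw [Fintype.sum_prod_type]
    simp only [← mul_sum, hW1]
    simp [← hN, hN0.ne']
  have gibbs := sum_negMulLog_le (fun z : Y × X => N⁻¹ * W z.1 z.2) (fun z => m z.2 * w z.1 z.2)
    (fun z => mul_nonneg (by positivity) (hW _ _)) (fun z => mul_nonneg (hm0 _) (hw0 _ _).le)
    (fun z hz => mul_pos (hmpos _ _ hz) (hw0 _ _)) (by
      rw [hj1, Fintype.sum_prod_type_right]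
      simp only [← mul_sum]
      exact (sum_le_sum fun x _ => mul_le_of_le_one_right (hm0 x) (hw1 x)).trans hm1.le)
  have hL : ∑ z : Y × X, Real.negMulLog (N⁻¹ * W z.1 z.2) = Real.log N + h := by
    rw [Fintype.sum_prod_type]
    simp_rw [Real.negMulLog_mul, sum_add_distrib, ← mul_sum, hh, ← sum_mul, hW1]
    simp only [sum_const, card_univ, nsmul_eq_mul, ← hN, Real.negMulLog, Real.log_inv]
    field_simp
  have hterm : ∀ z : Y × X, N⁻¹ * W z.1 z.2 * Real.log (m z.2 * w z.1 z.2) =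
      N⁻¹ * W z.1 z.2 * (Real.log (m z.2) - Real.log 2 - Real.log N) +
        (if z.1 = g z.2 then N⁻¹ * W z.1 z.2 * Real.log N else 0) := by
    intro z
    by_cases hz : N⁻¹ * W z.1 z.2 = 0
    · simp [hz]
    · have hp : 0 < m z.2 := hmpos z.1 z.2
        ((mul_nonneg (by positivity) (hW _ _)).lt_of_ne (Ne.symm hz))
      rw [Real.log_mul hp.ne' (hw0 _ _).ne']
      simp only [w]
      split_ifs
      · rw [one_div, Real.log_inv]; ring
      · rw [one_div, Real.log_inv, Real.log_mul two_ne_zero hN0.ne']; ring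
  have hR : ∑ z : Y × X, N⁻¹ * W z.1 z.2 * Real.log (m z.2 * w z.1 z.2) =
      -∑ x, Real.negMulLog (m x) - Real.log 2 - Real.log N +
        (N⁻¹ * ∑ x, W (g x) x) * Real.log N := by
    simp_rw [hterm]
    rw [sum_add_distrib]
    congr 1
    · rw [Fintype.sum_prod_type_right]
      simp only [← sum_mul, ← mul_sum]
      have : ∀ x, N⁻¹ * (∑ y, W y x) * (Real.log (m x) - Real.log 2 - Real.log N) =
          -Real.negMulLog (m x) - m x * Real.log 2 - m x * Real.log N := by
        intro x
        simp only [Real.negMulLog, hm]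
        ring
      simp_rw [this]
      rw [sum_sub_distrib, sum_sub_distrib, ← sum_mul, ← sum_mul, hm1, sum_neg_distrib]
      ring
    · rw [Fintype.sum_prod_type_right, mul_sum, sum_mul]
      refine sum_congr rfl fun x _ => ?_
      simp
  rw [hL, hR] at gibbs
  linarith

end Entropy

/-! ### The Bayes risk under the uniform prior -/

section Risk

variable {V : Type*} [Fintype V] [DecidableEq V] (G : SimpleGraph V) [DecidableRel G.Adj] {p : ℝ}
  (hp : p ∈ Set.Icc (0 : ℝ) (1 / 2))

lemma jointLaw_apply (y : Labels V) (X : Observations G) :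
    jointLaw G p hp (y, X) =
      (Fintype.card (Labels V) : ENNReal)⁻¹ * ENNReal.ofReal (obsProb G p y X) := by
  rw [jointLaw, PMF.bind_apply, tsum_fintype, sum_eq_single y]
  · rw [PMF.uniformOfFintype_apply, PMF.map_apply, tsum_fintype, sum_eq_single X]
    · simp [channel]
    · intro X' _ h
      simp [h.symm]
    · simp
  · intro y' _ h
    rw [PMF.map_apply]
    simp [h.symm]
  · simp

lemma errorProb_jointLaw_toReal (yhat : Observations G → Labels V) :
    (errorProb G yhat (jointLaw G p hp)).toReal =
      (Fintype.card (Labels V) : ℝ)⁻¹ *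
        ∑ y, ∑ X, if yhat X ≠ y then obsProb G p y X else 0 := by
  rw [errorProb, PMF.toOuterMeasure_apply_fintype, ENNReal.toReal_sum, Fintype.sum_prod_type,
    mul_sum]
  · refine sum_congr rfl fun y _ => ?_
    rw [mul_sum]
    refine sum_congr rfl fun X _ => ?_
    by_cases h : yhat X = y
    · simp [h]
    · simp [h, jointLaw_apply, ENNReal.toReal_ofReal (obsProb_nonneg G hp y X)]
  · intro w _
    exact ne_top_of_le_ne_top (PMF.apply_ne_top _ w) (Set.indicator_le_self _ _ _)

lemma errorProb_jointLaw_toReal_eq_one_sub (yhat : Observations G → Labels V) :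
    (errorProb G yhat (jointLaw G p hp)).toReal =
      1 - (Fintype.card (Labels V) : ℝ)⁻¹ * ∑ X, obsProb G p (yhat X) X := by
  have h : ∀ y X, (if yhat X ≠ y then obsProb G p y X else 0) =
      obsProb G p y X - if y = yhat X then obsProb G p y X else 0 := by
    intro y X
    by_cases h : y = yhat X <;> simp [h, Ne.symm]
  rw [errorProb_jointLaw_toReal]
  simp_rw [h, sum_sub_distrib, sum_obsProb]
  rw [sum_comm, mul_sub]
  simp

variable {G} in
lemma le_toReal_minimaxError {Q : Set (PMF (Labels V × Observations G))}
    (hQ : jointLaw G p hp ∈ Q) {c : ℝ}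
    (h : ∀ yhat, c ≤ (errorProb G yhat (jointLaw G p hp)).toReal) :
    c ≤ (minimaxError G Q).toReal := by
  have hle : ∀ (yhat : Observations G → Labels V) (P : PMF (Labels V × Observations G)),
      errorProb G yhat P ≤ 1 := fun yhat P =>
    (P.toOuterMeasure.mono (Set.subset_univ _)).trans
      (le_of_eq ((P.toOuterMeasure_apply_eq_one_iff _).2 (Set.subset_univ _)))
  have htop : minimaxError G Q ≠ ⊤ :=
    ne_top_of_le_ne_top ENNReal.one_ne_top
      ((iInf_le _ (fun _ => 1)).trans (iSup₂_le fun P _ => hle _ P))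
  rw [← ENNReal.ofReal_le_iff_le_toReal htop]
  refine le_iInf fun yhat => le_iSup₂_of_le _ hQ ?_
  rw [ENNReal.ofReal_le_iff_le_toReal (ne_top_of_le_ne_top ENNReal.one_ne_top (hle _ _))]
  exact h yhat

end Risk

/-! ### The testing bound at one vertex -/

section Testing

variable {V : Type*} (G : SimpleGraph V)

lemma edgeProduct_mul (y y' : Labels V) (e : G.edgeSet) :
    edgeProduct G (y * y') e = edgeProduct G y e * edgeProduct G y' e := by
  obtain ⟨⟨a, b⟩, h⟩ := e
  exact mul_mul_mul_comm _ _ _ _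

lemma edgeProduct_neg (y : Labels V) (e : G.edgeSet) :
    edgeProduct G (-y) e = edgeProduct G y e := by
  obtain ⟨⟨a, b⟩, h⟩ := e
  exact neg_mul_neg _ _

lemma edgeProduct_update_neg_ne_iff [DecidableEq V] (y : Labels V) (v : V) (e : G.edgeSet) :
    edgeProduct G y e ≠ edgeProduct G (Function.update y v (-y v)) e ↔ v ∈ e.1 := by
  obtain ⟨⟨a, b⟩, h⟩ := e
  have hab : a ≠ b := G.ne_of_adj h
  change y a * y b ≠ _ * _ ↔ v ∈ s(a, b)
  rw [Sym2.mem_iff]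
  by_cases ha : v = a
  · subst ha
    simp [hab.symm, units_ne_neg_self]
  · by_cases hb : v = b
    · subst hb
      simp [hab, units_ne_neg_self]
    · simp [ha, hb, Ne.symm]

variable [Fintype V] [DecidableEq V] [DecidableRel G.Adj] {p : ℝ} (hp : p ∈ Set.Icc (0 : ℝ) (1 / 2))

lemma card_edges_through (v : V) : Fintype.card {e : G.edgeSet // v ∈ e.1} = G.degree v := by
  rw [← G.card_incidenceFinset_eq_degree v, ← Fintype.card_coe]
  refine Fintype.card_congr
    ⟨fun e => ⟨e.1.1, by rw [G.mem_incidenceFinset]; exact ⟨e.1.2, e.2⟩⟩,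
      fun e => ⟨⟨e.1, ((G.mem_incidenceFinset v e.1).1 e.2).1⟩,
        ((G.mem_incidenceFinset v e.1).1 e.2).2⟩, fun _ => rfl, fun _ => rfl⟩

/-- Two label vectors that differ only at `v` are both equally likely a priori, and any estimator
errs on one of them; so the risk is at least half the overlap of their two laws. -/
lemma f1_degree_le_errorProb (v : V) (yhat : Observations G → Labels V) :
    f1 (G.degree v) p ≤ (errorProb G yhat (jointLaw G p hp)).toReal := by
  set N : ℝ := (Fintype.card (Labels V) : ℝ) with hN
  have hN0 : 0 < N := by rw [hN]; exact_mod_cast Fintype.card_pos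
  let flip : Labels V → Labels V := fun y => Function.update y v (-y v)
  have hflip : Function.Involutive flip := by
    intro y
    simp [flip]
  let err : Labels V → Observations G → ℝ := fun y X =>
    if yhat X ≠ y then obsProb G p y X else 0
  have herr : ∑ y, ∑ X, err (flip y) X = ∑ y, ∑ X, err y X :=
    Equiv.sum_comp hflip.toPerm (fun y => ∑ X, err y X)
  have hmin : ∀ y X, min (obsProb G p y X) (obsProb G p (flip y) X) ≤
      err y X + err (flip y) X := by
    intro y X
    have h0 := obsProb_nonneg G hp y X
    have h1 := obsProb_nonneg G hp (flip y) X
    have hne : y ≠ flip y := fun h => by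
      have := congrFun h v
      simp only [flip, Function.update_self] at this
      exact units_ne_neg_self _ this
    by_cases h : yhat X = y
    · simp only [err, h, ne_eq, not_true, if_false, zero_add]
      rw [if_pos hne]
      exact min_le_right _ _
    · simp only [err, h, ne_eq, not_false_eq_true, if_true]
      refine (min_le_left _ _).trans (le_add_of_nonneg_right ?_)
      split_ifs <;> simp [h1]
  have hsum : ∀ y, 2 * f1 (G.degree v) p ≤ ∑ X, err y X + ∑ X, err (flip y) X := by
    intro y
    rw [← sum_add_distrib]
    refine le_trans (le_of_eq ?_) (sum_le_sum fun X _ => hmin y X)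
    have hd : Fintype.card {e : G.edgeSet // edgeProduct G y e ≠ edgeProduct G (flip y) e} =
        G.degree v := by
      rw [← card_edges_through G v]
      exact Fintype.card_congr
        (Equiv.subtypeEquivRight fun e => edgeProduct_update_neg_ne_iff G y v e)
    have := sum_min_prod_edgeProb hp (edgeProduct G y) (edgeProduct G (flip y)) hd
    unfold obsProb f1
    rw [this]
    ring
  have htot : N * (2 * f1 (G.degree v) p) ≤ 2 * ∑ y, ∑ X, err y X := by
    have := sum_le_sum fun y (_ : y ∈ univ) => hsum y
    rw [sum_add_distrib, herr, sum_const, card_univ, nsmul_eq_mul, ← hN] at this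
    linarith
  rw [errorProb_jointLaw_toReal, ← hN, ← div_eq_inv_mul, le_div_iff₀ hN0]
  simp only [err] at htot
  linarith

end Testing

/-! ### Edge cuts and expansion -/

section Cuts

variable {V : Type*} [Fintype V] [DecidableEq V] (G : SimpleGraph V) [DecidableRel G.Adj]

lemma cheeger_mul_card_le {S : Finset V} (h1 : 1 ≤ #S) (h2 : #S ≤ Fintype.card V / 2) :
    cheeger G * #S ≤ #(G.interedges S Sᶜ) := by
  rw [← le_div_iff₀ (by exact_mod_cast h1)]
  exact ciInf_le (f := fun S : {S : Finset V // 1 ≤ #S ∧ #S ≤ Fintype.card V / 2} =>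
    (#(G.interedges S.1 S.1ᶜ) : ℝ) / #S.1) (Set.finite_range _).bddBelow ⟨S, h1, h2⟩

lemma card_interedges_le_card_edgeProduct_ne_one (u : Labels V) :
    #(G.interedges ({v | u v ≠ 1} : Finset V) ({v | u v ≠ 1} : Finset V)ᶜ) ≤
      #{e | edgeProduct G u e ≠ 1} := by
  rw [← card_map (Function.Embedding.subtype fun e => e ∈ G.edgeSet),
    ← card_image_of_injOn (f := fun z : V × V => s(z.1, z.2))
      (s := G.interedges ({v | u v ≠ 1} : Finset V) ({v | u v ≠ 1} : Finset V)ᶜ)]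
  · refine card_le_card fun e he => ?_
    obtain ⟨⟨a, b⟩, hab, rfl⟩ := mem_image.1 he
    rw [SimpleGraph.mem_interedges_iff] at hab
    simp only [mem_compl, mem_filter, mem_univ, true_and, not_not] at hab
    obtain ⟨ha, hb, hadj⟩ := hab
    refine mem_map.2 ⟨⟨s(a, b), hadj⟩, mem_filter.2 ⟨mem_univ _, ?_⟩, rfl⟩
    change u a * u b ≠ 1
    rwa [hb, mul_one]
  · -- an edge of the cut has exactly one orientation that starts in the set
    rintro ⟨a, b⟩ hab ⟨c, d⟩ hcd h
    simp only [mem_coe, SimpleGraph.mem_interedges_iff, mem_compl, mem_filter, mem_univ,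
      true_and, not_not] at hab hcd
    rcases Sym2.eq_iff.1 h with ⟨rfl, rfl⟩ | ⟨rfl, rfl⟩
    · rfl
    · exact absurd hcd.2.1 hab.1

/-- Expansion bounds the number of edges whose ends carry different signs; passing to `-u` if
necessary makes the class of negative signs the smaller one. -/
lemma cheeger_mul_min_le (u : Labels V) (h1 : 1 ≤ #{v | u v ≠ 1})
    (h2 : #{v | u v ≠ 1} ≤ Fintype.card V - 1) :
    cheeger G * (min #{v | u v ≠ 1} (Fintype.card V - #{v | u v ≠ 1}) : ℕ) ≤
      #{e | edgeProduct G u e ≠ 1} := by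
  have hneg : #{v | (-u) v ≠ 1} = Fintype.card V - #{v | u v ≠ 1} := by
    rw [← card_compl]
    congr 1
    ext v
    rcases Int.units_eq_one_or (u v) with h | h <;> simp [h]
  rcases le_total #{v | u v ≠ 1} (Fintype.card V - #{v | u v ≠ 1}) with h | h
  · rw [min_eq_left h]
    refine (cheeger_mul_card_le G h1 (by omega)).trans ?_
    exact_mod_cast card_interedges_le_card_edgeProduct_ne_one G u
  · rw [min_eq_right h, ← hneg]
    refine (cheeger_mul_card_le G (by omega) (by omega)).trans ?_
    have := card_interedges_le_card_edgeProduct_ne_one G (-u)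
    simp_rw [edgeProduct_neg] at this
    exact_mod_cast this

end Cuts

/-! ### Gauge fixing along a spanning tree -/

section Gauge

variable {V : Type*} [Fintype V] (G : SimpleGraph V)

/-- On the edges of a spanning tree every sign pattern is the edge-product vector of some labels:
labels normalized at a root are determined by it, and there are as many of the one as of the
other. -/
lemma exists_edges_forall_exists_labels (hG : G.Connected) :
    ∃ P : G.edgeSet → Prop, Nat.card {e // P e} + 1 = Fintype.card V ∧
      ∀ t : {e // P e} → ℤˣ, ∃ y : Labels V, ∀ e, edgeProduct G y e.1 = t e := by
  classical
  obtain ⟨T, hTG, hT⟩ := hG.exists_isTree_le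
  obtain ⟨r⟩ := hG.nonempty
  have hcard : Fintype.card {e : G.edgeSet // e.1 ∈ T.edgeSet} + 1 = Fintype.card V := by
    rw [← hT.card_edgeFinset, ← Fintype.card_coe]
    congr 1
    exact Fintype.card_congr
      ⟨fun e => ⟨e.1.1, SimpleGraph.mem_edgeFinset.2 e.2⟩,
        fun e => ⟨⟨e.1, SimpleGraph.edgeSet_mono hTG (SimpleGraph.mem_edgeFinset.1 e.2)⟩,
          SimpleGraph.mem_edgeFinset.1 e.2⟩, fun _ => rfl, fun _ => rfl⟩
  refine ⟨fun e => e.1 ∈ T.edgeSet, by rw [Nat.card_eq_fintype_card, hcard], ?_⟩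
  let lift : ({v // v ≠ r} → ℤˣ) → Labels V := fun w v => if h : v ≠ r then w ⟨v, h⟩ else 1
  let f : ({v // v ≠ r} → ℤˣ) → ({e : G.edgeSet // e.1 ∈ T.edgeSet} → ℤˣ) :=
    fun w e => edgeProduct G (lift w) e.1
  have hinj : Function.Injective f := by
    intro w w' h
    have hstep : ∀ a b, T.Adj a b → lift w a = lift w' a → lift w b = lift w' b := by
      intro a b hab ha
      have h1 : lift w a * lift w b = lift w' a * lift w' b :=
        congrFun h ⟨⟨s(a, b), hTG hab⟩, hab⟩
      rw [ha] at h1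
      exact mul_left_cancel h1
    have hall : ∀ a b, T.Walk a b → lift w a = lift w' a → lift w b = lift w' b := by
      intro a b q
      induction q with
      | nil => exact id
      | cons hadj _ ih => exact fun ha => ih (hstep _ _ hadj ha)
    funext v
    obtain ⟨q⟩ := hT.connected.preconnected r v
    have := hall r v q (by simp [lift])
    simpa [lift, v.2] using this
  have hbij : Function.Bijective f := by
    rw [Fintype.bijective_iff_injective_and_card]
    refine ⟨hinj, ?_⟩
    rw [Fintype.card_fun, Fintype.card_fun]
    congr 1
    have : Fintype.card {v // v ≠ r} = Fintype.card V - 1 := by simp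
    omega
  intro t
  obtain ⟨w, rfl⟩ := hbij.surjective t
  exact ⟨lift w, fun _ => rfl⟩

variable [DecidableEq V] [DecidableRel G.Adj]

/-- A function of the observations that is controlled by the number of edges on which they
disagree with *some* labels can be summed after gauge fixing: choosing the labels that match the
observations on a spanning tree leaves only the edges off the tree, and the number of those that
are off is binomial. -/
lemma sum_observations_le (hG : G.Connected) (F : Observations G → ℝ) (Ψ : ℕ → ℝ)
    (hF : ∀ X y, F X ≤ Ψ #{e | X e ≠ edgeProduct G y e}) :
    ∑ X, F X ≤ 2 ^ (Fintype.card V - 1) *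
      ∑ k ∈ range (#G.edgeFinset + 1 - Fintype.card V + 1),
        ((#G.edgeFinset + 1 - Fintype.card V).choose k : ℝ) * Ψ k := by
  classical
  obtain ⟨P, hP, hsurj⟩ := exists_edges_forall_exists_labels G hG
  rw [Nat.card_eq_fintype_card] at hP
  choose σ hσ using hsurj
  have hco : Fintype.card {e // ¬ P e} = #G.edgeFinset + 1 - Fintype.card V := by
    have h1 : #G.edgeFinset = Fintype.card G.edgeSet := SimpleGraph.edgeFinset_card
    have h2 := Fintype.card_subtype_compl P
    have h3 := Fintype.card_subtype_le P
    omega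
  let e := Equiv.piEquivPiSubtypeProd P (fun _ : G.edgeSet => ℤˣ)
  have hcount : ∀ t z, F (e.symm (t, z)) ≤
      Ψ #{i : {i // ¬ P i} | z i ≠ edgeProduct G (σ t) i.1} := by
    intro t z
    refine (hF _ (σ t)).trans (le_of_eq (congrArg Ψ ?_))
    rw [← card_map (Function.Embedding.subtype fun i => ¬ P i)]
    congr 1
    ext i
    simp only [mem_filter, mem_univ, true_and, mem_map, Function.Embedding.subtype_apply,
      Subtype.exists, exists_and_right, exists_eq_right]
    by_cases hi : P i
    · simp [e, Equiv.piEquivPiSubtypeProd, hi, hσ t ⟨i, hi⟩]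
    · simp [e, Equiv.piEquivPiSubtypeProd, hi]
  have ht : Fintype.card ({i // P i} → ℤˣ) = 2 ^ (Fintype.card V - 1) := by
    rw [Fintype.card_fun, Fintype.card_units_int]
    congr 1
    omega
  calc ∑ X, F X = ∑ t, ∑ z, F (e.symm (t, z)) := by
        rw [← Fintype.sum_prod_type', ← e.symm.sum_comp]
    _ ≤ ∑ t : {i // P i} → ℤˣ, ∑ z : {i // ¬ P i} → ℤˣ,
          Ψ #{i : {i // ¬ P i} | z i ≠ edgeProduct G (σ t) i.1} :=
        sum_le_sum fun t _ => sum_le_sum fun z _ => hcount t z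
    _ = _ := by
        simp_rw [sum_signs_card (fun i : {i // ¬ P i} => edgeProduct G (σ _) i.1) Ψ]
        rw [sum_const, card_univ, ht, hco]
        simp [nsmul_eq_mul]

end Gauge

/-! ### The entropy of the observations -/

section Marginal

/-- `τ` as a full binomial sum, the two terms `k = 0` and `k = n` being exceptional. -/
lemma tau_eq_sum {n : ℕ} (hn : n ≠ 0) (φ p : ℝ) (b : ℕ) :
    tau n φ p b = ∑ k ∈ range (n + 1), n.choose k • (if k = 0 ∨ k = n then (p / (1 - p)) ^ b else
      (p / (1 - p)) ^ (max (φ * (min k (n - k) : ℕ) - (b : ℝ)) 0 : ℝ)) := by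
  have h : range (n + 1) = insert 0 (insert n (Icc 1 (n - 1))) := by
    ext k
    simp only [mem_range, mem_insert, mem_Icc]
    omega
  rw [h, sum_insert (by simp [hn.symm]), sum_insert (by simp; omega)]
  simp only [true_or, or_true, if_true, Nat.choose_zero_right, Nat.choose_self, one_smul, tau]
  rw [← add_assoc, two_mul]
  congr 1
  refine sum_congr rfl fun k hk => ?_
  rw [mem_Icc] at hk
  rw [if_neg (by omega), nsmul_eq_mul]

lemma tau_le_two_pow {n : ℕ} (hn : n ≠ 0) {φ p : ℝ} (hp : p ∈ Set.Icc (0 : ℝ) (1 / 2)) (b : ℕ) :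
    tau n φ p b ≤ 2 ^ n := by
  have h0 : 0 ≤ p / (1 - p) := div_nonneg hp.1 (by linarith [hp.2])
  have h1 : p / (1 - p) ≤ 1 := div_le_one_of_le₀ (by linarith [hp.2]) (by linarith [hp.2])
  rw [tau_eq_sum hn]
  calc _ ≤ ∑ k ∈ range (n + 1), n.choose k • (1 : ℝ) := by
        refine sum_le_sum fun k _ => nsmul_le_nsmul_right ?_ _
        split_ifs
        · exact pow_le_one₀ h0 h1
        · exact Real.rpow_le_one h0 h1 (le_max_right _ _)
    _ = 2 ^ n := by
        simp only [nsmul_eq_mul, mul_one]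
        exact_mod_cast Nat.sum_range_choose n

variable {V : Type*} [Fintype V] [DecidableEq V] (G : SimpleGraph V) [DecidableRel G.Adj] {p : ℝ}
  (hp : p ∈ Set.Icc (0 : ℝ) (1 / 2))

lemma card_labels : Fintype.card (Labels V) = 2 ^ Fintype.card V := by
  rw [Fintype.card_fun, Fintype.card_units_int]

lemma card_observations : Fintype.card (Observations G) = 2 ^ #G.edgeFinset := by
  rw [Fintype.card_fun, Fintype.card_units_int, SimpleGraph.edgeFinset_card]

omit [DecidableEq V] in
include hp in
lemma obsProb_eq (y : Labels V) (X : Observations G) :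
    obsProb G p y X =
      (1 - p) ^ #G.edgeFinset * (p / (1 - p)) ^ #{e | X e ≠ edgeProduct G y e} := by
  have hq : 1 - p ≠ 0 := by linarith [hp.2]
  have hle : #{e | X e ≠ edgeProduct G y e} ≤ #G.edgeFinset := by
    rw [SimpleGraph.edgeFinset_card]
    exact card_le_univ _
  rw [obsProb, prod_edgeProb, ← SimpleGraph.edgeFinset_card, ← pow_sub_mul_pow (1 - p) hle,
    div_pow, mul_assoc, mul_div_cancel₀ _ (pow_ne_zero _ hq), mul_comm]

include hp in
/-- If `X` disagrees with the labels `y` on `b` edges, then it disagrees with `y * u` on at least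
`|cut u| - b` edges, and expansion bounds the size of the cut of `u` from below. -/
lemma sum_pow_card_le_tau (hV : Fintype.card V ≠ 0) (hp0 : 0 < p) (y : Labels V)
    (X : Observations G) :
    ∑ y' : Labels V, (p / (1 - p)) ^ #{e | X e ≠ edgeProduct G y' e} ≤
      tau (Fintype.card V) (cheeger G) p #{e | X e ≠ edgeProduct G y e} := by
  have h0 : 0 < p / (1 - p) := div_pos hp0 (by linarith [hp.2])
  have h1 : p / (1 - p) ≤ 1 := div_le_one_of_le₀ (by linarith [hp.2]) (by linarith [hp.2])
  -- reindex by the relative signs `u`, grouped by the number of vertices where `u` is negative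
  rw [tau_eq_sum hV, ← sum_signs_card (fun _ : V => (1 : ℤˣ)), ← Equiv.sum_comp (Equiv.mulLeft y)]
  refine sum_le_sum fun u _ => ?_
  simp only [Equiv.coe_mulLeft]
  split_ifs with hu
  · have huy : ∀ e, edgeProduct G (y * u) e = edgeProduct G y e := by
      intro e
      rcases hu with hu | hu
      · have : u = 1 := by
          funext v
          simpa using filter_eq_empty_iff.1 (card_eq_zero.1 hu) (mem_univ v)
        rw [this, mul_one]
      · have : u = -1 := by
          funext v
          exact Int.units_ne_iff_eq_neg.1 (filter_card_eq hu v (mem_univ v))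
        rw [this, mul_neg_one, edgeProduct_neg]
    simp_rw [huy]
    exact le_rfl
  · push Not at hu
    have hle : #{v | u v ≠ 1} ≤ Fintype.card V := card_le_univ _
    have hcut := cheeger_mul_min_le G u (by omega) (by omega)
    have htri : #{e | edgeProduct G u e ≠ 1} ≤ #{e | X e ≠ edgeProduct G (y * u) e} +
        #{e | X e ≠ edgeProduct G y e} := by
      refine (card_le_card fun e he => ?_).trans (card_union_le _ _)
      simp only [mem_filter, mem_univ, true_and, mem_union, edgeProduct_mul] at he ⊢
      by_contra! hcon
      rw [hcon.2] at hcon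
      exact he (by simpa using hcon.1)
    have htri' : (#{e | edgeProduct G u e ≠ 1} : ℝ) ≤ #{e | X e ≠ edgeProduct G (y * u) e} +
        #{e | X e ≠ edgeProduct G y e} := by exact_mod_cast htri
    rw [← Real.rpow_natCast]
    refine Real.rpow_le_rpow_of_exponent_ge h0 h1 (max_le ?_ (Nat.cast_nonneg _))
    exact sub_le_iff_le_add.2 (hcut.trans htri')

/-- The probability of the observation `X`. -/
noncomputable def marginal (p : ℝ) (X : Observations G) : ℝ :=
  (Fintype.card (Labels V) : ℝ)⁻¹ * ∑ y, obsProb G p y X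

include hp in
lemma marginal_nonneg (X : Observations G) : 0 ≤ marginal G p X :=
  mul_nonneg (by positivity) (sum_nonneg fun y _ => obsProb_nonneg G hp y X)

lemma sum_marginal : ∑ X, marginal G p X = 1 := by
  simp only [marginal]
  rw [← mul_sum, sum_comm]
  simp [sum_obsProb]

include hp in
lemma marginal_le (hV : Fintype.card V ≠ 0) (hp0 : 0 < p) (y : Labels V) (X : Observations G) :
    marginal G p X ≤ (1 - p) ^ #G.edgeFinset *
      (tau (Fintype.card V) (cheeger G) p #{e | X e ≠ edgeProduct G y e} /
        2 ^ Fintype.card V) := by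
  have hq : 0 ≤ 1 - p := by linarith [hp.2]
  simp_rw [marginal, obsProb_eq G hp, ← mul_sum, card_labels]
  push_cast
  rw [mul_left_comm, div_eq_inv_mul (tau _ _ _ _)]
  exact mul_le_mul_of_nonneg_left (mul_le_mul_of_nonneg_left
    (sum_pow_card_le_tau G hp hV hp0 y X) (by positivity)) (pow_nonneg hq _)

lemma binomialHalfExp_eq_sum (N : ℕ) (h : ℕ → ℝ) :
    2 ^ N * binomialHalfExp N h = ∑ k ∈ range (N + 1), (N.choose k : ℝ) * h k := by
  rw [binomialHalfExp, ProbabilityTheory.integral_binomial, mul_sum]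
  refine sum_congr (by ext; simp) fun k hk => ?_
  have hk' : k ≤ N := by simp at hk; omega
  have : (1 / 2 : ℝ) ^ k * (1 - 1 / 2) ^ (N - k) = (2 ^ N)⁻¹ := by
    rw [show (1 - 1 / 2 : ℝ) = 1 / 2 by norm_num, ← pow_add, Nat.add_sub_cancel' hk', one_div,
      inv_pow]
  simp only [smul_eq_mul]
  rw [mul_assoc (N.choose k : ℝ), this]
  field_simp

lemma kappa1_eq_sum {n E : ℕ} (hn : n ≠ 0) (hE : n ≤ E + 1) (φ : ℝ)
    (hp : p ∈ Set.Icc (0 : ℝ) (1 / 2)) (hp0 : 0 < p) :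
    kappa1 n E φ p = 2 ^ (n - 1) * ∑ k ∈ range (E + 1 - n + 1), ((E + 1 - n).choose k : ℝ) *
      Real.negMulLog ((1 - p) ^ E * (tau n φ p k / 2 ^ n)) := by
  have hq : 0 < 1 - p := by linarith [hp.2]
  have hE2 : (2 : ℝ) ^ E = 2 ^ (n - 1) * 2 ^ (E + 1 - n) := by
    rw [← pow_add]
    congr 1
    omega
  have hterm : ∀ k, Real.negMulLog ((1 - p) ^ E * (tau n φ p k / 2 ^ n)) =
      -(E : ℝ) * Real.log (1 - p) * (1 - p) ^ E * (tau n φ p k / 2 ^ n) +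
        (1 - p) ^ E * (-(tau n φ p k / 2 ^ n) * Real.log (tau n φ p k / 2 ^ n)) := by
    intro k
    rw [Real.negMulLog_mul]
    simp only [Real.negMulLog, Real.log_pow]
    ring
  have h1 := binomialHalfExp_eq_sum (E + 1 - n) (fun b => tau n φ p b / 2 ^ n)
  have h2 := binomialHalfExp_eq_sum (E + 1 - n)
    (fun b => -(tau n φ p b / 2 ^ n) * Real.log (tau n φ p b / 2 ^ n))
  simp_rw [hterm, mul_add, sum_add_distrib]
  have hpull : ∀ (c : ℝ) (h : ℕ → ℝ), ∑ k ∈ range (E + 1 - n + 1),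
      ((E + 1 - n).choose k : ℝ) * (c * h k) =
        c * ∑ k ∈ range (E + 1 - n + 1), ((E + 1 - n).choose k : ℝ) * h k := by
    intro c h
    rw [mul_sum]
    exact sum_congr rfl fun k _ => mul_left_comm _ _ _
  rw [hpull, hpull _ (fun k => -(tau n φ p k / 2 ^ n) * Real.log (tau n φ p k / 2 ^ n)),
    ← h1, ← h2, kappa1, mul_pow, hE2]
  ring

include hp in
/-- The entropy of the observations is at most `κ₁`: up to the point `exp (-1)` the function
`t ↦ -t * log t` is increasing, so the bound on the marginal law bounds its entropy. -/
lemma sum_negMulLog_marginal_le_kappa1 (hG : G.Connected) (hp0 : 0 < p)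
    (hE : (1 - p) ^ #G.edgeFinset ≤ Real.exp (-1)) :
    ∑ X, Real.negMulLog (marginal G p X) ≤
      kappa1 (Fintype.card V) #G.edgeFinset (cheeger G) p := by
  have := hG.nonempty
  have hV : Fintype.card V ≠ 0 := Fintype.card_ne_zero
  have hVE : Fintype.card V ≤ #G.edgeFinset + 1 := by
    have := hG.card_vert_le_card_edgeSet_add_one
    simpa [Nat.card_eq_fintype_card, SimpleGraph.edgeFinset_card] using this
  rw [kappa1_eq_sum hV hVE _ hp hp0]
  refine sum_observations_le G hG _
    (fun b => Real.negMulLog ((1 - p) ^ #G.edgeFinset *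
      (tau (Fintype.card V) (cheeger G) p b / 2 ^ Fintype.card V))) fun X y => ?_
  have hle := marginal_le G hp hV hp0 y X
  have htau : tau (Fintype.card V) (cheeger G) p #{e | X e ≠ edgeProduct G y e} /
      2 ^ Fintype.card V ≤ 1 := div_le_one_of_le₀ (tau_le_two_pow hV hp _) (by positivity)
  have hq : (0 : ℝ) ≤ (1 - p) ^ #G.edgeFinset := pow_nonneg (by linarith [hp.2]) _
  have hexp := (mul_le_of_le_one_right hq htau).trans hE
  have h0 := marginal_nonneg G hp X
  have := Real.mul_log_strictAntiOn.antitoneOn ⟨h0, hle.trans hexp⟩ ⟨h0.trans hle, hexp⟩ hle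
  simp only [Real.negMulLog_eq_neg]
  exact neg_le_neg this

end Marginal

/-! ### The entropy bounds -/

section EntropyBounds

variable {V : Type*} [Fintype V] [DecidableEq V] (G : SimpleGraph V) [DecidableRel G.Adj] {p : ℝ}
  (hp : p ∈ Set.Icc (0 : ℝ) (1 / 2))

lemma sum_negMulLog_obsProb (y : Labels V) :
    ∑ X, Real.negMulLog (obsProb G p y X) = #G.edgeFinset * Real.binEntropy p := by
  have h : ∀ e, ∑ x, Real.negMulLog (edgeProb p x (edgeProduct G y e)) = Real.binEntropy p := by
    intro e
    rw [Real.binEntropy_eq_negMulLog_add_negMulLog_one_sub]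
    rcases Int.units_eq_one_or (edgeProduct G y e) with h | h <;>
      simp [h, edgeProb, add_comm]
  unfold obsProb
  rw [sum_negMulLog_prod (fun e x => edgeProb p x (edgeProduct G y e)) fun e => sum_edgeProb p _]
  simp_rw [h]
  rw [sum_const, card_univ, nsmul_eq_mul, SimpleGraph.edgeFinset_card]

/-- Any bound `B` on the entropy of the observations bounds the risk from below, by Fano's
inequality. -/
lemma fano_le_errorProb [Nonempty V] {B : ℝ} (hB : ∑ X, Real.negMulLog (marginal G p X) ≤ B)
    (yhat : Observations G → Labels V) :
    ((Fintype.card V : ℝ) - 1) / Fintype.card V -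
        (B - #G.edgeFinset * Real.binEntropy p) / (Fintype.card V * Real.log 2) ≤
      (errorProb G yhat (jointLaw G p hp)).toReal := by
  have hfano := fano (obsProb G p) (obsProb_nonneg G hp) (sum_obsProb G p)
    (sum_negMulLog_obsProb G) yhat
  rw [errorProb_jointLaw_toReal_eq_one_sub]
  set s := (Fintype.card (Labels V) : ℝ)⁻¹ * ∑ X, obsProb G p (yhat X) X
  have hlog : Real.log (Fintype.card (Labels V)) = Fintype.card V * Real.log 2 := by
    rw [card_labels]
    push_cast
    rw [Real.log_pow]
  rw [hlog] at hfano
  have hl : 0 < Real.log 2 := Real.log_pos one_lt_two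
  have hn : (0 : ℝ) < Fintype.card V := by exact_mod_cast Fintype.card_pos
  change _ ≤ Real.log 2 + ∑ X, Real.negMulLog (marginal G p X) - _ at hfano
  have hs : s ≤ (Real.log 2 + B - #G.edgeFinset * Real.binEntropy p) /
      (Fintype.card V * Real.log 2) := by
    rw [le_div_iff₀ (by positivity)]
    linarith
  have : (Real.log 2 + B - #G.edgeFinset * Real.binEntropy p) / (Fintype.card V * Real.log 2) =
      1 - (((Fintype.card V : ℝ) - 1) / Fintype.card V -
        (B - #G.edgeFinset * Real.binEntropy p) / (Fintype.card V * Real.log 2)) := by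
    field_simp
    ring
  linarith

lemma g1_le_errorProb [Nonempty V] (yhat : Observations G → Labels V) :
    g1 (Fintype.card V) #G.edgeFinset p ≤ (errorProb G yhat (jointLaw G p hp)).toReal := by
  have hl : Real.log 2 ≠ 0 := (Real.log_pos one_lt_two).ne'
  have hn : (Fintype.card V : ℝ) ≠ 0 := by exact_mod_cast Fintype.card_ne_zero
  refine le_trans (le_of_eq ?_) (fano_le_errorProb G hp
    (sum_negMulLog_le_log_card _ (marginal_nonneg G hp) (sum_marginal G)) yhat)
  rw [card_observations]
  push_cast
  rw [Real.log_pow, g1]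
  field_simp

lemma g1star_le_errorProb (hG : G.Connected) (yhat : Observations G → Labels V) :
    g1star (Fintype.card V) #G.edgeFinset (cheeger G) p ≤
      (errorProb G yhat (jointLaw G p hp)).toReal := by
  have := hG.nonempty
  have hg1 := g1_le_errorProb G hp yhat
  rw [g1star]
  split_ifs with hE
  · rcases le_total (#G.edgeFinset * Real.log 2 -
      kappa1 (Fintype.card V) #G.edgeFinset (cheeger G) p) 0 with h | h
    · rwa [max_eq_right h, zero_div, zero_mul, add_zero]
    · -- at `p = 0` the threshold condition fails, so `p` is positive here
      have hp0 : 0 < p := by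
        refine hp.1.lt_of_ne ?_
        rintro rfl
        have : Real.exp (-1) < 1 := by simp
        simp only [sub_zero, one_pow] at hE
        linarith
      have hl : Real.log 2 ≠ 0 := (Real.log_pos one_lt_two).ne'
      have hn : (Fintype.card V : ℝ) ≠ 0 := by exact_mod_cast Fintype.card_ne_zero
      refine le_trans (le_of_eq ?_) (fano_le_errorProb G hp
        (sum_negMulLog_marginal_le_kappa1 G hp hG hp0 hE) yhat)
      rw [max_eq_left h, g1]
      field_simp
      ring
  · rwa [mul_zero, add_zero]

end EntropyBounds

end EdgeRecovery

/-- Minimax lower bound for exact recovery from noisy edge observations. -/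
theorem theorem1 {V : Type*} [Fintype V] [DecidableEq V]
    (G : SimpleGraph V) [DecidableRel G.Adj] (hG : G.Connected)
    (p : ℝ) (hp : p ∈ Set.Icc (0 : ℝ) (1 / 2))
    (Q : Set (PMF (EdgeRecovery.Labels V × EdgeRecovery.Observations G)))
    (hQ : EdgeRecovery.jointLaw G p hp ∈ Q) :
    max (EdgeRecovery.f1 G.maxDegree p)
        (max (EdgeRecovery.g1 (Fintype.card V) G.edgeFinset.card p)
          (EdgeRecovery.g1star (Fintype.card V) G.edgeFinset.card (EdgeRecovery.cheeger G) p)) ≤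
      (EdgeRecovery.minimaxError G Q).toReal := by
  have := hG.nonempty
  refine EdgeRecovery.le_toReal_minimaxError hp hQ fun yhat => max_le ?_ (max_le ?_ ?_)
  · obtain ⟨v, hv⟩ := G.exists_maximal_degree_vertex
    rw [hv]
    exact EdgeRecovery.f1_degree_le_errorProb G hp v yhat
  · exact EdgeRecovery.g1_le_errorProb G hp yhat
  · exact EdgeRecovery.g1star_le_errorProb G hp hG yhat
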